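/- Let $I,O$ be finite disjoint sets of input and output signals, let $\varphi$ be an $\mathrm{LTL}[\mathcal F]$ formula over $I\cup O$, and let $\psi$ be an $\mathrm{LTL}$ formula over $I$. (Here $\mathcal F$ is any set of functions $[0,1]^k\to[0,1]$, $k\in\mathbb N$; formulas are built from $\mathtt{True}$, $\mathtt{False}$, atomic propositions, functions in $\mathcal F$, $\mathsf X$ and $\mathsf U$, and the satisfaction value $[\![\pi,\varphi]\!]\in[0,1]$ in $\pi\in(2^{I\cup O})^\omega$ is defined as usual, with $\mathsf U$ interpreted by $\max_i\min\{[\![\pi^i,\varphi_2]\!],\min_{j<i}[\![\pi^j,\varphi_1]\!]\}$.) Equip $(2^I)^\omega$ with the uniform (i.i.d. uniform letters) distribution and assume $\Pr(w\models\psi)>0$. Let $V(\varphi)=\{[\![\pi,\varphi]\!]:\pi\in(2^{I\cup O})^\omega\}=\{v_1<\dots<v_n\}$. Let $\mathcal A_\psi$ be a deterministic parity automaton (DPW; total transition function, finitely many states, a run accepts iff the maximal rank of the states visited infinitely often is even) over $2^I$ with language $\{w:w\models\psi\}$, and for each $l$ let $\mathcal A_l$ be a DPW over $2^{I\cup O}$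 with state set $Q^l$, rank function $\alpha^l$ and language $\{\pi:[\![\pi,\varphi]\!]=v_l\}$. A transition function $\delta$ on a state set $Q$ over $2^{I\cup O}$ induces transition probabilities $\mathrm P(q,o,q')=|\{i\in2^I:\delta(q,i\cup o)=q'\}|/2^{|I|}$ with actions $o\in 2^O$. An end component is a set $C$ of states for which there are nonempty action sets $(B_s)_{s\in C}$ such that any two states of $C$ are connected by a path inside $C$ using positive-probability transitions of actions in the sets $B_s$, and such that from $s\in C$ under any $a\in B_s$ the next state is in $C$ with probability $1$. *The MDP $\mathcal M$.* Its states are those of the product $\mathcal A_\psi\times\mathcal A_1\times\dots\times\mathcal A_n$ (where $\mathcal A_\psi$ ignores the output part of a letter), its initial state $s_0$ is the tuple of initial states, its actions are $2^O$ in every state, and its transition probabilities are those induced by the product. The reward $\gamma(s)$ of a state $s=\langle q,q_1,\dots,q_n\rangle$ that lies in some end component of $\mathcal M$ is the largest $v_l$ such that $q_l$ belongs to an end component $U$ of the MDP induced by $\mathcal A_l$ in which the maximal rank $\max_{p\in U}\alpha^l(p)$ is even ($0$ if there is no such $l$); all other states have reward $0$. *The reset MDP $\mathcal M'$.* It is $\mathcal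 M$, except that from every state whose $\mathcal A_\psi$-component lies in a rejecting ergodic component every action leads to $s_0$ with probability $1$. Here an ergodic component is a nonempty strongly connected set of states, closed under positive-probability transitions, of the Markov chain obtained by running $\mathcal A_\psi$ on uniformly random letters of $2^I$; it is rejecting if the maximal rank in it is odd. A strategy is a function $f:S^+\to 2^O$ from nonempty state sequences to actions. The reward of an infinite run $s_0,s_1,\dots$ is $\liminf_{m\to\infty}\frac1m\sum_{j=0}^m\gamma(s_j)$. For a strategy $f$, let $R_{\mathcal M,f}$ be the reward of the run generated by $f$ in $\mathcal M$ on the random input word $w=i_0i_1\cdots$ (in history $s_0\cdots s_j$ the next state is the successor of $s_j$ under the letter $i_j\cup f(s_0\cdots s_j)$), and for a strategy $g$ let $R_{\mathcal M',g}$ be the reward of a random run of the Markov chain induced by $g$ in $\mathcal M'$. Then for every $v\in\mathbb R$: if $f$ is a strategy in $\mathcal M$ with $\mathbb E[R_{\mathcal M,f}\mid w\models\psi]\ge v$, then there is a strategy $g$ in $\mathcal M'$ with $\mathbb E[R_{\mathcal M',g}]\ge v$. -/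

import Mathlib

/-!
Signals: `I` (inputs) and `O` (outputs) are finite types; a letter of `2^I` is a `Finset I`, a letter
of `2^{I ∪ O}` is a `Finset (I ⊕ O)`, and `i ∪ o` is `Finset.disjSum i o`. An infinite word over `Σ`
is a function `ℕ → Σ`.
-/

noncomputable section

open MeasureTheory ProbabilityTheory Filter

namespace QualSynth

/-! ### Temporal logics -/

/-- The suffix `π_j, π_{j+1}, …` of an infinite word. -/
def suffix {σ : Type*} (π : ℕ → σ) (j : ℕ) : ℕ → σ := fun k => π (j + k)

/-- Formulas of LTL[F] over the atomic propositions `AP`; `F k` is the set of `k`-ary quality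
operators `[0,1]^k → [0,1]`. -/
inductive FLTL (AP : Type*) (F : (k : ℕ) → Set ((Fin k → unitInterval) → unitInterval))
  | tt : FLTL AP F
  | ff : FLTL AP F
  | atom (p : AP) : FLTL AP F
  | op {k : ℕ} (f : (Fin k → unitInterval) → unitInterval) (hf : f ∈ F k)
      (args : Fin k → FLTL AP F) : FLTL AP F
  | next (φ : FLTL AP F) : FLTL AP F
  | untl (φ₁ φ₂ : FLTL AP F) : FLTL AP F

open Classical in
/-- The satisfaction value of an LTL[F] formula in a computation. -/
def FLTL.sem {AP : Type*} {F : (k : ℕ) → Set ((Fin k → unitInterval) → unitInterval)} :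
    FLTL AP F → (ℕ → Finset AP) → unitInterval
  | .tt, _ => 1
  | .ff, _ => 0
  | .atom p, π => if p ∈ π 0 then 1 else 0
  | .op f _ args, π => f (fun l => (args l).sem π)
  | .next φ, π => φ.sem (suffix π 1)
  | .untl φ₁ φ₂, π =>
      ⨆ i : ℕ, min (φ₂.sem (suffix π i)) (⨅ j : Fin i, φ₁.sem (suffix π j))

/-- `V(φ)`: the set of satisfaction values of `φ` in arbitrary computations. -/
def FLTL.values {AP : Type*} {F : (k : ℕ) → Set ((Fin k → unitInterval) → unitInterval)}
    (φ : FLTL AP F) : Set ℝ :=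
  Set.range fun π : ℕ → Finset AP => (φ.sem π : ℝ)

/-- Formulas of (Boolean) linear temporal logic. -/
inductive LTL (AP : Type*)
  | tt : LTL AP
  | ff : LTL AP
  | atom (p : AP) : LTL AP
  | neg (ψ : LTL AP) : LTL AP
  | conj (ψ₁ ψ₂ : LTL AP) : LTL AP
  | disj (ψ₁ ψ₂ : LTL AP) : LTL AP
  | next (ψ : LTL AP) : LTL AP
  | untl (ψ₁ ψ₂ : LTL AP) : LTL AP

/-- `w ⊨ ψ`. -/
def LTL.Sat {AP : Type*} : LTL AP → (ℕ → Finset AP) → Prop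
  | .tt, _ => True
  | .ff, _ => False
  | .atom p, w => p ∈ w 0
  | .neg ψ, w => ¬ ψ.Sat w
  | .conj ψ₁ ψ₂, w => ψ₁.Sat w ∧ ψ₂.Sat w
  | .disj ψ₁ ψ₂, w => ψ₁.Sat w ∨ ψ₂.Sat w
  | .next ψ, w => ψ.Sat (suffix w 1)
  | .untl ψ₁ ψ₂, w => ∃ i, ψ₂.Sat (suffix w i) ∧ ∀ j < i, ψ₁.Sat (suffix w j)

/-! ### Deterministic parity automata -/

/-- A deterministic parity automaton with alphabet `σ` and state space `Q`. -/
structure DPW (σ Q : Type*) where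
  init : Q
  step : Q → σ → Q
  index : ℕ
  rank : Q → ℕ
  rank_mem : ∀ q, rank q ∈ Set.Icc 1 index

/-- The run of the automaton on a word. -/
def DPW.run {σ Q : Type*} (A : DPW σ Q) (w : ℕ → σ) : ℕ → Q
  | 0 => A.init
  | j + 1 => A.step (A.run w j) (w j)

/-- The states that occur infinitely often in a run. -/
def infStates {Q : Type*} (r : ℕ → Q) : Set Q := {q | ∃ᶠ j in atTop, r j = q}

/-- The language of the automaton: the maximal rank occurring infinitely often is even. -/
def DPW.language {σ Q : Type*} (A : DPW σ Q) : Set (ℕ → σ) :=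
  {w | ∃ m, IsGreatest (A.rank '' infStates (A.run w)) m ∧ Even m}

/-! ### Markov chains and Markov decision processes -/

/-- A Markov chain with (countable) state space `S`. -/
structure MarkovChain (S : Type*) where
  init : S
  trans : S → PMF S

/-- The `n`-th step of the chain as a kernel from the first `n + 1` states to the next state. -/
def MarkovChain.stepKernel {S : Type*} [Countable S] [MeasurableSpace S]
    [DiscreteMeasurableSpace S] (M : MarkovChain S) (n : ℕ) :
    Kernel ((i : Finset.Iic n) → (fun _ : ℕ => S) i) S :=
  (Kernel.ofFunOfCountable fun s => (M.trans s).toMeasure).comap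
    (fun h => h ⟨n, Finset.mem_Iic.2 le_rfl⟩) (measurable_pi_apply _)

instance {S : Type*} [Countable S] [MeasurableSpace S] [DiscreteMeasurableSpace S]
    (M : MarkovChain S) (n : ℕ) : IsMarkovKernel (M.stepKernel n) :=
  ⟨fun h => inferInstanceAs (IsProbabilityMeasure
    (M.trans (h ⟨n, Finset.mem_Iic.2 le_rfl⟩)).toMeasure)⟩

/-- The probability measure induced by the chain on its infinite runs. -/
def MarkovChain.runMeasure {S : Type*} [Countable S] [MeasurableSpace S]
    [DiscreteMeasurableSpace S] (M : MarkovChain S) : Measure (ℕ → S) :=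
  Kernel.traj (X := fun _ => S) M.stepKernel 0 (fun _ => M.init)

/-- An ergodic component: strongly connected, and closed under transitions of positive
probability. -/
def MarkovChain.IsErgodicComponent {S : Type*} (M : MarkovChain S) (C : Set S) : Prop :=
  C.Nonempty ∧
  (∀ s ∈ C, ∀ t ∈ C,
    Relation.ReflTransGen (fun x y => x ∈ C ∧ y ∈ C ∧ 0 < M.trans x y) s t) ∧
  ∀ s ∈ C, ∀ t ∉ C, M.trans s t = 0

/-- `S⁺`: the pair of `past = t ∈ S^*` and `cur = s ∈ S` stands for the nonempty sequence `t · s`. -/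
@[ext]
structure History (S : Type*) where
  past : List S
  cur : S

/-- The history `t · s · s'`. -/
def History.snoc {S : Type*} (u : History S) (s : S) : History S := ⟨u.past ++ [u.cur], s⟩

instance {S : Type*} : MeasurableSpace (History S) := ⊤

instance {S : Type*} : DiscreteMeasurableSpace (History S) := ⟨fun _ => trivial⟩

instance {S : Type*} [Countable S] : Countable (History S) :=
  Function.Injective.countable (f := fun u : History S => (u.past, u.cur)) fun u v h => by
    cases u; cases v; simpa using h

/-- A Markov decision process with state space `S`, in which all the actions of `A` are available
in every state. -/
structure MDP (S A : Type*) where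
  init : S
  trans : S → A → PMF S
  reward : S → ℝ

/-- A (deterministic, history-dependent) strategy `S⁺ → A`. -/
abbrev Strategy (S A : Type*) := History S → A

/-- The Markov chain on `S⁺` in which the choice of actions is resolved by `f`. -/
def MDP.chain {S A : Type*} (M : MDP S A) (f : Strategy S A) : MarkovChain (History S) where
  init := ⟨[], M.init⟩
  trans u := (M.trans u.cur (f u)).map u.snoc

/-- The mean payoff `liminf_m (1/m) ∑_{j=0}^m γ(s_j)` of a run of the chain induced by a strategy. -/
def MDP.payoff {S A : Type*} (M : MDP S A) (r : ℕ → History S) : ℝ :=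
  liminf (fun m : ℕ => (1 / (m : ℝ)) * ∑ j ∈ Finset.range (m + 1), M.reward (r j).cur) atTop

/-- The value of a strategy: its expected mean payoff. -/
def MDP.val {S A : Type*} [Countable S] (M : MDP S A) (f : Strategy S A) : ℝ :=
  ∫ r, M.payoff r ∂(M.chain f).runMeasure

/-- An end component with respect to the transition function `P`. -/
def IsEndComponent {S A : Type*} (P : S → A → PMF S) (C : Set S) : Prop :=
  ∃ B : S → Set A,
    (∀ s ∈ C, (B s).Nonempty) ∧
    (∀ s ∈ C, ∀ t ∈ C,
      Relation.ReflTransGen (fun x y => x ∈ C ∧ y ∈ C ∧ ∃ a ∈ B x, 0 < P x a y) s t) ∧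
    ∀ s ∈ C, ∀ a ∈ B s, ∑' t : C, P s a t = 1

/-! ### The MDPs of the synthesis problem -/

/-- The transition function of the pre-MDP induced by a transition function over `2^{I ∪ O}`:
when action `o` is chosen in `q`, an input `i` is sampled uniformly and the next state is
`δ(q, i ∪ o)`. -/
def inducedTrans {I O Q : Type*} [Fintype I] (δ : Q → Finset (I ⊕ O) → Q) (q : Q) (o : Finset O) :
    PMF Q :=
  (PMF.uniformOfFintype (Finset I)).map fun i => δ q (i.disjSum o)

/-- `q` is a controllably win recurrent state of the parity MDP of `A`, with witness `U`. -/
def IsCWR {I O Q : Type*} [Fintype I] (A : DPW (Finset (I ⊕ O)) Q) (q : Q) (U : Set Q) : Prop :=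
  IsEndComponent (inducedTrans A.step) U ∧ q ∈ U ∧ (∀ p ∈ U, A.rank p ≤ A.rank q) ∧
    Even (A.rank q)

/-- The Markov chain obtained by running an automaton over `2^I` on uniformly random inputs. -/
def inputChain {I Q : Type*} [Fintype I] (A : DPW (Finset I) Q) : MarkovChain Q where
  init := A.init
  trans q := (PMF.uniformOfFintype (Finset I)).map fun i => A.step q i

/-- A rejecting ergodic component: the maximal rank that appears in it is odd. -/
def IsRejectingComponent {I Q : Type*} [Fintype I] (A : DPW (Finset I) Q) (C : Set Q) : Prop :=
  (inputChain A).IsErgodicComponent C ∧ ∃ m, IsGreatest (A.rank '' C) m ∧ Odd m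

/-- The transition function of the product `A_ψ × A_1 × ⋯ × A_n`; `A_ψ` reads only the input part of
the letter. -/
def prodStep {I O : Type*} {n : ℕ} {Qψ : Type*} {Q : Fin n → Type*} (Aψ : DPW (Finset I) Qψ)
    (A : ∀ l, DPW (Finset (I ⊕ O)) (Q l)) (s : Qψ × (∀ l, Q l)) (a : Finset (I ⊕ O)) :
    Qψ × (∀ l, Q l) :=
  (Aψ.step s.1 a.toLeft, fun l => (A l).step (s.2 l) a)

open Classical in
/-- The conditional achievability MDP. The reward of a state that lies in some end component is the
maximal value achievable from it; the reward of all other states is `0`. -/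
def condMDP {I O : Type*} [Fintype I] {n : ℕ} {Qψ : Type*} {Q : Fin n → Type*}
    (Aψ : DPW (Finset I) Qψ) (v : Fin n → ℝ) (A : ∀ l, DPW (Finset (I ⊕ O)) (Q l)) :
    MDP (Qψ × (∀ l, Q l)) (Finset O) where
  init := (Aψ.init, fun l => (A l).init)
  trans := inducedTrans (prodStep Aψ A)
  reward s :=
    if ∃ C, IsEndComponent (inducedTrans (prodStep Aψ A)) C ∧ s ∈ C then
      sSup {x | ∃ l, v l = x ∧ ∃ q U, IsCWR (A l) q U ∧ s.2 l ∈ U}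
    else 0

open Classical in
/-- The reset MDP: from every state whose `A_ψ`-component lies in a rejecting ergodic component,
every action leads back to the initial state with probability one. -/
def resetMDP {I O : Type*} [Fintype I] {n : ℕ} {Qψ : Type*} {Q : Fin n → Type*}
    (Aψ : DPW (Finset I) Qψ) (v : Fin n → ℝ) (A : ∀ l, DPW (Finset (I ⊕ O)) (Q l)) :
    MDP (Qψ × (∀ l, Q l)) (Finset O) where
  init := (condMDP Aψ v A).init
  trans s o :=
    if ∃ C, IsRejectingComponent Aψ C ∧ s.1 ∈ C then PMF.pure (condMDP Aψ v A).init
    else (condMDP Aψ v A).trans s o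
  reward := (condMDP Aψ v A).reward

/-- The uniform distribution on `(2^I)^ω`. -/
def inputMeasure (I : Type*) [Fintype I] : Measure (ℕ → Finset I) :=
  Measure.infinitePi fun _ => (PMF.uniformOfFintype (Finset I)).toMeasure

/-- The run that a strategy generates, in the MDP of a pre-automaton over `2^{I ∪ O}`, on an input
word: in history `u` the strategy chooses `f u`, and the state moves according to the letter
`w_j ∪ f u`. -/
def inputRun {I O S : Type*} (δ : S → Finset (I ⊕ O) → S) (s₀ : S)
    (f : Strategy S (Finset O)) (w : ℕ → Finset I) : ℕ → History S
  | 0 => ⟨[], s₀⟩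
  | j + 1 =>
      (inputRun δ s₀ f w j).snoc
        (δ (inputRun δ s₀ f w j).cur ((w j).disjSum (f (inputRun δ s₀ f w j))))

/-- The random variable that maps an input word to the mean payoff of the run generated on it by the
strategy `f` in the conditional achievability MDP. -/
def condReward {I O : Type*} [Fintype I] {n : ℕ} {Qψ : Type*} {Q : Fin n → Type*}
    (Aψ : DPW (Finset I) Qψ) (v : Fin n → ℝ) (A : ∀ l, DPW (Finset (I ⊕ O)) (Q l))
    (f : Strategy (Qψ × (∀ l, Q l)) (Finset O)) (w : ℕ → Finset I) : ℝ :=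
  (condMDP Aψ v A).payoff (inputRun (prodStep Aψ A) (condMDP Aψ v A).init f w)

/-- The conditional expectation of the mean payoff of `f` given `w ⊨ ψ`. -/
def condVal {I O : Type*} [Fintype I] {n : ℕ} {Qψ : Type*} {Q : Fin n → Type*}
    (ψ : LTL I) (Aψ : DPW (Finset I) Qψ) (v : Fin n → ℝ)
    (A : ∀ l, DPW (Finset (I ⊕ O)) (Q l))
    (f : Strategy (Qψ × (∀ l, Q l)) (Finset O)) : ℝ :=
  ∫ w, condReward Aψ v A f w ∂(cond (inputMeasure I) {w | ψ.Sat w})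

/-! ### Consistency of the two descriptions of random runs -/

/-- The run measure is the one given by the cylinder sets: `Pr(Cone(r)) = Pr(r)`. -/
theorem MarkovChain.runMeasure_cone {S : Type*} [Countable S] [MeasurableSpace S]
    [DiscreteMeasurableSpace S] (M : MarkovChain S) (u : ℕ → S) (hu : u 0 = M.init) (n : ℕ) :
    M.runMeasure {r | ∀ j ≤ n, r j = u j} =
      ∏ j ∈ Finset.range n, M.trans (u j) (u (j + 1)) := by
  have key : ∀ n, Kernel.partialTraj (X := fun _ => S) M.stepKernel 0 n (fun _ => M.init)
      {fun i : Finset.Iic n => u i} = ∏ j ∈ Finset.range n, M.trans (u j) (u (j + 1)) := by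
    intro n
    induction n with
    | zero =>
      rw [Kernel.partialTraj_self, Kernel.id_apply, Measure.dirac_apply' _ (measurableSet_singleton _)]
      have : (fun _ => M.init : (i : Finset.Iic 0) → S) ∈ ({fun i : Finset.Iic 0 => u i} : Set ((i : Finset.Iic 0) → S)) := by
        ext ⟨i, hi⟩
        have : i = 0 := by simpa using hi
        subst this; exact hu.symm
      simp [Set.indicator_of_mem this]
    | succ n ih =>
      rw [Kernel.partialTraj_succ_of_le (Nat.zero_le n),
        Kernel.map_apply' _ (by fun_prop) _ (measurableSet_singleton _)]
      have hpre : (IicProdIoc (X := fun _ => S) n (n + 1)) ⁻¹' {fun i : Finset.Iic (n + 1) => u i} =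
          {fun i : Finset.Iic n => u i} ×ˢ
            ((MeasurableEquiv.piSingleton (X := fun _ => S) n) '' {u (n + 1)}) := by
        ext ⟨a, b⟩
        simp only [Set.mem_preimage, Set.mem_singleton_iff, Set.mem_prod, Set.image_singleton]
        constructor
        · intro h
          constructor
          · ext ⟨i, hi⟩
            have h1 := congrFun h ⟨i, by simp at hi ⊢; omega⟩
            have hi' : i ≤ n := by simpa using hi
            simpa [IicProdIoc, hi'] using h1
          · rw [← MeasurableEquiv.symm_apply_eq]
            have h1 := congrFun h ⟨n + 1, by simp⟩
            simpa [IicProdIoc, MeasurableEquiv.piSingleton] using h1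
        · rintro ⟨rfl, h2⟩
          rw [← MeasurableEquiv.symm_apply_eq] at h2
          ext ⟨i, hi⟩
          have hi' : i ≤ n + 1 := by simpa using hi
          by_cases h : i ≤ n
          · simp [IicProdIoc, h]
          · have : i = n + 1 := by omega
            subst this
            simpa [IicProdIoc, MeasurableEquiv.piSingleton] using h2
      have hm : MeasurableSet ((MeasurableEquiv.piSingleton (X := fun _ => S) n) '' {u (n + 1)}) := by
        rw [Set.image_singleton]; exact measurableSet_singleton _
      have : IsMarkovKernel ((M.stepKernel n).map (MeasurableEquiv.piSingleton (X := fun _ => S) n)) :=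
        Kernel.IsMarkovKernel.map _ (by fun_prop)
      rw [hpre, Kernel.comp_apply' _ _ _ ((measurableSet_singleton _).prod hm)]
      have : ∀ h, (Kernel.id ×ₖ (M.stepKernel n).map (MeasurableEquiv.piSingleton (X := fun _ => S) n)) h
          ({fun i : Finset.Iic n => u i} ×ˢ
            ((MeasurableEquiv.piSingleton (X := fun _ => S) n) '' {u (n + 1)})) =
          ({fun i : Finset.Iic n => u i} : Set ((i : Finset.Iic n) → S)).indicator
            (fun _ => M.trans (u n) (u (n + 1))) h := by
        intro h
        rw [Kernel.prod_apply, Measure.prod_prod, Kernel.id_apply,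
          Measure.dirac_apply' _ (measurableSet_singleton _),
          Kernel.map_apply' _ (by fun_prop) _ hm,
          Set.preimage_image_eq _ (MeasurableEquiv.injective _)]
        by_cases hh : h = fun i : Finset.Iic n => u i
        · subst hh
          simp only [Set.mem_singleton_iff, Set.indicator_of_mem, Pi.one_apply, one_mul]
          show (M.trans (u n)).toMeasure {u (n + 1)} = _
          rw [PMF.toMeasure_apply_singleton _ _ (measurableSet_singleton _)]
        · simp [Set.indicator, hh]
      simp_rw [this]
      rw [lintegral_indicator (measurableSet_singleton _), setLIntegral_const, ih,
        Finset.prod_range_succ, mul_comm]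
  rw [← key n, ← Kernel.traj_map_frestrictLe_apply, Measure.map_apply (by fun_prop) (measurableSet_singleton _)]
  rw [runMeasure]
  congr 1
  ext r
  simp [funext_iff, Preorder.frestrictLe]

/-- Under uniformly random inputs, the run generated by a strategy has the same cylinder probabilities
as the Markov chain induced by the strategy. -/
theorem inputMeasure_cone {I O S : Type*} [Fintype I]  (M : MDP S (Finset O))
    (δ : S → Finset (I ⊕ O) → S) (hδ : M.trans = inducedTrans δ) (f : Strategy S (Finset O))
    (u : ℕ → History S) (hu : u 0 = ⟨[], M.init⟩) (n : ℕ) :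
    inputMeasure I {w | ∀ j ≤ n, inputRun δ M.init f w j = u j} =
      ∏ j ∈ Finset.range n, (M.chain f).trans (u j) (u (j + 1)) := by
  have : {w : ℕ → Finset I | ∀ j ≤ n, inputRun δ M.init f w j = u j} =
      Set.pi (Finset.range n) fun j =>
        {i | (u j).snoc (δ (u j).cur (i.disjSum (f (u j)))) = u (j + 1)} := by
    ext w
    simp only [Set.mem_ofPred_eq, Set.mem_pi, Finset.coe_range, Set.mem_Iio]
    constructor
    · intro h j hj
      have h1 := h (j + 1) hj
      rw [inputRun, h j hj.le] at h1
      exact h1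
    · intro h j
      induction j with
      | zero => intro _; rw [hu]; rfl
      | succ j ih =>
        intro hj
        rw [inputRun, ih (by omega)]
        exact h j hj
  rw [this, inputMeasure, Measure.infinitePi_pi _ (fun i _ => Set.Finite.measurableSet (Set.toFinite _))]
  refine Finset.prod_congr rfl fun j _ => ?_
  simp only [MDP.chain, hδ, inducedTrans, PMF.map_comp]
  rw [← PMF.toMeasure_apply_singleton _ (u (j + 1)) (measurableSet_singleton _),
    PMF.toMeasure_map_apply _ _ _ (fun s _ => Set.Finite.measurableSet (Set.toFinite _))
      (measurableSet_singleton _)]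
  rfl

end QualSynth

end

/-!
Let `g` play `f`, forgetting the past after each visit to a state whose `A_ψ`-component lies in a
rejecting ergodic component, that is, after each reset. After the first reset the run of `g` starts
anew on the remaining letters, which are independent of the past, and the mean payoff ignores
prefixes; until then `g` and `f` produce the same run. Hence the expected payoff `e` of `g`
satisfies the renewal equation `e = Pr(some reset) · e + E[payoff of f; no reset]`, so that `e` is
the conditional expectation of the payoff of `f` given that there is no reset. By Lévy's form of the
Borel–Cantelli lemma the states that `A_ψ` visits infinitely often almost surely form an ergodic
component, and therefore the event that there is no reset agrees with `w ⊨ ψ` up to a null set.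
-/

namespace QualSynth

open MeasureTheory ProbabilityTheory Filter

/-! ### Independent letters -/

theorem suffix_zero {σ : Type*} (w : ℕ → σ) : suffix w 0 = w := by
  funext k; simp only [suffix, zero_add]

theorem suffix_add {σ : Type*} (w : ℕ → σ) (s t : ℕ) :
    suffix w (s + t) = suffix (suffix w s) t := by
  funext k; simp only [suffix, add_assoc]

theorem dependsOn_Iio_of_step {X P : Type*} {r : ℕ → (ℕ → X) → P} {p : P} {F : P → X → P}
    (h_zero : ∀ w, r 0 w = p) (h_succ : ∀ j w, r (j + 1) w = F (r j w) (w j)) (j : ℕ) :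
    DependsOn (r j) (Set.Iio j) := by
  induction j with
  | zero => exact fun w w' _ => (h_zero w).trans (h_zero w').symm
  | succ j ih =>
    intro w w' hww'
    have hr : r j w = r j w' := ih fun i hi => hww' i (Set.Iio_subset_Iio j.le_succ hi)
    rw [h_succ, h_succ, hr, hww' j j.lt_succ_self]

section IIDLaw

variable {X : Type*} [MeasurableSpace X]

/-- The law of an infinite word whose letters are independent with distribution `ν`. -/
noncomputable abbrev iidLaw (ν : Measure X) : Measure (ℕ → X) := Measure.infinitePi fun _ => ν

/-- The information carried by the letters of an infinite word up to a given time, inclusive. -/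
abbrev letterFiltration (X : Type*) [MeasurableSpace X] :
    Filtration ℕ (MeasurableSpace.pi : MeasurableSpace (ℕ → X)) :=
  Filtration.piLE

theorem measurable_suffix (t : ℕ) : Measurable fun w : ℕ → X => suffix w t :=
  measurable_pi_lambda _ fun k => measurable_pi_apply (t + k)

theorem measurePreserving_suffix (ν : Measure X) [IsProbabilityMeasure ν] (t : ℕ) :
    MeasurePreserving (fun w => suffix w t) (iidLaw ν) (iidLaw ν) where
  measurable := measurable_suffix t
  map_eq := Measure.map_infinitePi_infinitePi_of_inj (P := fun _ => ν) (f := fun k => t + k)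
    (add_right_injective t)

theorem measurable_eval_letterFiltration (t : ℕ) :
    Measurable[letterFiltration X t] fun w : ℕ → X => w t :=
  (measurable_pi_apply (⟨t, Set.self_mem_Iic⟩ : Set.Iic t)).comp
    (comap_measurable (Preorder.restrictLe (π := fun _ => X) t))

theorem measurable_letterFiltration_of_dependsOn [Countable X] [MeasurableSingletonClass X]
    {Y : Type*} [MeasurableSpace Y] {F : (ℕ → X) → Y} {t : ℕ} (hF : DependsOn F (Set.Iic t)) :
    Measurable[letterFiltration X t] F := by
  rcases isEmpty_or_nonempty Y with hY | hY
  · exact @measurable_of_empty_codomain _ _ (_) _ hY F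
  · obtain ⟨G, rfl⟩ := dependsOn_iff_exists_comp.1 hF
    exact (Measurable.of_discrete (f := G)).comp (comap_measurable _)

theorem measurableSet_letterFiltration_of_dependsOn [Countable X] [MeasurableSingletonClass X]
    {E : Set (ℕ → X)} {t : ℕ} (hE : DependsOn (· ∈ E) (Set.Iic t)) :
    MeasurableSet[letterFiltration X t] E :=
  (@measurableSet_setOfPred _ (_) _).2 (measurable_letterFiltration_of_dependsOn hE)

theorem indep_comap_suffix_letterFiltration (ν : Measure X) [IsProbabilityMeasure ν] (t : ℕ) :
    Indep (MeasurableSpace.comap (fun w => suffix w (t + 1)) inferInstance)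
      (letterFiltration X t) (iidLaw ν) := by
  let m (i : ℕ) : MeasurableSpace (ℕ → X) := MeasurableSpace.comap (fun w => w i) inferInstance
  have hletter {T : Set ℕ} {i : ℕ} (hi : i ∈ T) :
      Measurable[⨆ j ∈ T, m j] fun w : ℕ → X => w i :=
    (comap_measurable _).mono (le_iSup₂_of_le i hi le_rfl) le_rfl
  have hindep : Indep (⨆ i ∈ Set.Ioi t, m i) (⨆ i ∈ Set.Iic t, m i) (iidLaw ν) :=
    indep_iSup_of_disjoint (fun i => (measurable_pi_apply i).comap_le)
      (iIndepFun_infinitePi (X := fun _ x => x) fun _ => measurable_id)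
      (Set.Iic_disjoint_Ioi le_rfl).symm
  refine indep_of_indep_of_le_left (indep_of_indep_of_le_right hindep ?_) ?_
  · exact (@measurable_pi_lambda _ _ _ (_) _ _ fun i => hletter i.2).comap_le
  · exact (@measurable_pi_lambda _ _ _ (_) _ _ fun k => hletter (Set.mem_Ioi.2 (by omega))).comap_le

theorem condExp_comp_suffix (ν : Measure X) [IsProbabilityMeasure ν] (t : ℕ) {h : (ℕ → X) → ℝ}
    (hh : Measurable h) :
    (iidLaw ν)[fun w => h (suffix w (t + 1)) | letterFiltration X t]
      =ᵐ[iidLaw ν] fun _ => ∫ w, h w ∂iidLaw ν := by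
  have hmean : ∫ w, h (suffix w (t + 1)) ∂iidLaw ν = ∫ w, h w ∂iidLaw ν := by
    rw [← (measurePreserving_suffix ν (t + 1)).map_eq,
      integral_map (measurable_suffix _).aemeasurable hh.aestronglyMeasurable,
      (measurePreserving_suffix ν (t + 1)).map_eq]
  rw [← hmean]
  exact condExp_indep_eq (measurable_suffix (t + 1)).comap_le (Filtration.le _ t)
    (hh.comp (comap_measurable _)).stronglyMeasurable (indep_comap_suffix_letterFiltration ν t)

theorem measureReal_mul_integral_of_renewal (ν : Measure X) [IsProbabilityMeasure ν]
    {V : ℕ → Set (ℕ → X)} (hV : ∀ t, MeasurableSet[letterFiltration X t] (V t))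
    {h : (ℕ → X) → ℝ} (hh : Measurable h) (hint : Integrable h (iidLaw ν))
    (hrenew : ∀ t, ∀ w ∈ disjointed V t, h w = h (suffix w (t + 1))) :
    (iidLaw ν).real (⋃ t, V t)ᶜ * ∫ w, h w ∂iidLaw ν = ∫ w in (⋃ t, V t)ᶜ, h w ∂iidLaw ν := by
  have hfirst t : MeasurableSet[letterFiltration X t] (disjointed V t) := by
    rw [disjointed_eq_inter_compl]
    exact (hV t).inter <| .iInter fun j => .iInter fun hj =>
      (Filtration.mono _ hj.le _ (hV j)).compl
  have hfirst' t : MeasurableSet (disjointed V t) := Filtration.le _ t _ (hfirst t)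
  have hV' : MeasurableSet (⋃ t, V t) := .iUnion fun t => Filtration.le _ t _ (hV t)
  have hdisj : Pairwise (Function.onFun Disjoint (disjointed V)) := disjoint_disjointed V
  have hfirst_integral t : ∫ w in disjointed V t, h w ∂iidLaw ν =
      (iidLaw ν).real (disjointed V t) * ∫ w, h w ∂iidLaw ν := by
    have hint' : Integrable (fun w => h (suffix w (t + 1))) (iidLaw ν) :=
      (measurePreserving_suffix ν (t + 1)).integrable_comp_of_integrable hint
    rw [setIntegral_congr_fun (hfirst' t) (hrenew t),
      ← setIntegral_condExp (Filtration.le _ t) hint' (hfirst t),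
      integral_congr_ae (ae_restrict_of_ae (condExp_comp_suffix ν t hh)), setIntegral_const,
      smul_eq_mul]
  have hunion : ∫ w in ⋃ t, V t, h w ∂iidLaw ν =
      (iidLaw ν).real (⋃ t, V t) * ∫ w, h w ∂iidLaw ν := by
    rw [← iUnion_disjointed, integral_iUnion hfirst' hdisj hint.integrableOn,
      measureReal_def, measure_iUnion hdisj hfirst',
      ENNReal.tsum_toReal_eq fun t => measure_ne_top _ _, ← tsum_mul_right]
    exact tsum_congr hfirst_integral
  have hsplit := integral_add_compl hV' hint
  rw [probReal_compl_eq_one_sub hV']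
  linarith

theorem condExp_indicator_eval_succ (ν : Measure X) [IsProbabilityMeasure ν] {s : Set X}
    (hs : MeasurableSet s) (t : ℕ) :
    (iidLaw ν)[{w | w (t + 1) ∈ s}.indicator 1 | letterFiltration X t]
      =ᵐ[iidLaw ν] fun _ => ν.real s := by
  have hfirst : MeasurableSet {w : ℕ → X | w 0 ∈ s} := measurable_pi_apply 0 hs
  have hmean : ∫ w, {w | w 0 ∈ s}.indicator (1 : (ℕ → X) → ℝ) w ∂iidLaw ν = ν.real s := by
    rw [integral_indicator_one hfirst]
    exact congrArg ENNReal.toReal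
      ((measurePreserving_eval_infinitePi (fun _ => ν) 0).measure_preimage hs.nullMeasurableSet)
  rw [← hmean]
  exact condExp_comp_suffix ν t (measurable_one.indicator hfirst)

/-- Lévy's conditional form of the second Borel–Cantelli lemma applies, since the next letter is
independent of `E n`. -/
theorem ae_frequently_mem_and_eval_succ_mem (ν : Measure X) [IsProbabilityMeasure ν] {s : Set X}
    (hs : MeasurableSet s) (hνs : ν s ≠ 0) {E : ℕ → Set (ℕ → X)}
    (hE : ∀ n, MeasurableSet[letterFiltration X n] (E n)) :
    ∀ᵐ w ∂iidLaw ν, (∃ᶠ n in atTop, w ∈ E n) → ∃ᶠ n in atTop, w ∈ E n ∧ w (n + 1) ∈ s := by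
  let L (n : ℕ) : Set (ℕ → X) := {w | w n ∈ s}
  let G : ℕ → Set (ℕ → X)
    | 0 => ∅
    | n + 1 => E n ∩ L (n + 1)
  have hL n : MeasurableSet (L n) := measurable_pi_apply n hs
  have hG : ∀ n, MeasurableSet[letterFiltration X n] (G n)
    | 0 => @MeasurableSet.empty _ (_)
    | n + 1 => (Filtration.mono _ n.le_succ _ (hE n)).inter <|
        measurable_eval_letterFiltration (n + 1) hs
  have hcond n : (iidLaw ν)[(G (n + 1)).indicator 1 | letterFiltration X n]
      =ᵐ[iidLaw ν] (E n).indicator fun _ => ν.real s := by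
    have hLint : Integrable ((L (n + 1)).indicator (1 : (ℕ → X) → ℝ)) (iidLaw ν) :=
      (integrable_const 1).indicator (hL (n + 1))
    filter_upwards [condExp_indicator hLint (hE n), condExp_indicator_eval_succ ν hs n] with w h₁ h₂
    classical
    rw [Set.indicator_indicator] at h₁
    rw [h₁, Set.indicator_apply, Set.indicator_apply, h₂]
  filter_upwards [ae_mem_limsup_atTop_iff (iidLaw ν) hG, ae_all_iff.2 hcond] with w hw hcond
  intro h
  have hpos : 0 < ν.real s := ENNReal.toReal_pos hνs (measure_ne_top _ _)
  rw [← mem_limsup_iff_frequently_mem, Set.limsup_eq_tendsto_sum_indicator_atTop hpos,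
    Set.mem_ofPred_eq] at h
  have hmem : w ∈ limsup G atTop := hw.2 (by simpa only [hcond] using h)
  rwa [← limsup_nat_add G 1, mem_limsup_iff_frequently_mem] at hmem

end IIDLaw

/-! ### Mean payoffs -/

/-- The mean payoff of a sequence of rewards, normalised as in `MDP.payoff`: the average over the
first `m + 1` rewards is divided by `m`, and is `0` for `m = 0`. -/
noncomputable def meanPayoff (c : ℕ → ℝ) : ℝ :=
  liminf (fun m : ℕ => (1 / (m : ℝ)) * ∑ j ∈ Finset.range (m + 1), c j) atTop

theorem liminf_eq_of_tendsto_sub {ι : Type*} {l : Filter ι} [l.NeBot] {u v : ι → ℝ}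
    (hle : IsBoundedUnder (· ≤ ·) l u) (hge : IsBoundedUnder (· ≥ ·) l u)
    (h : Tendsto (fun i => v i - u i) l (nhds 0)) : liminf v l = liminf u l := by
  have hv : v = (fun i => v i - u i) + u := by funext i; simp
  refine le_antisymm ?_ ?_
  · have := liminf_add_le h.isBoundedUnder_ge h.isBoundedUnder_le hge hle.isCoboundedUnder_ge
    rwa [← hv, h.limsup_eq, zero_add] at this
  · have := le_liminf_add h.isBoundedUnder_ge h.isBoundedUnder_le hge hle.isCoboundedUnder_ge
    rwa [← hv, h.liminf_eq, zero_add] at this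

theorem abs_average_le {c : ℕ → ℝ} {B : ℝ} (hc : ∀ j, |c j| ≤ B) (m : ℕ) :
    |(1 / (m : ℝ)) * ∑ j ∈ Finset.range (m + 1), c j| ≤ 2 * B := by
  have hB : 0 ≤ B := (abs_nonneg _).trans (hc 0)
  rcases m.eq_zero_or_pos with rfl | hm
  · simpa using hB
  have hsum : |∑ j ∈ Finset.range (m + 1), c j| ≤ (m + 1) * B := by
    refine (Finset.abs_sum_le_sum_abs _ _).trans ?_
    simpa using Finset.sum_le_card_nsmul (Finset.range (m + 1)) _ B fun j _ => hc j
  have hm' : (1 : ℝ) ≤ m := by exact_mod_cast hm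
  rw [abs_mul, abs_of_nonneg (by positivity), one_div, inv_mul_le_iff₀ (by positivity)]
  nlinarith

theorem isBoundedUnder_le_average {c : ℕ → ℝ} {B : ℝ} (hc : ∀ j, |c j| ≤ B) :
    IsBoundedUnder (· ≤ ·) atTop
      fun m : ℕ => (1 / (m : ℝ)) * ∑ j ∈ Finset.range (m + 1), c j :=
  isBoundedUnder_of ⟨2 * B, fun m => (abs_le.1 (abs_average_le hc m)).2⟩

theorem isBoundedUnder_ge_average {c : ℕ → ℝ} {B : ℝ} (hc : ∀ j, |c j| ≤ B) :
    IsBoundedUnder (· ≥ ·) atTop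
      fun m : ℕ => (1 / (m : ℝ)) * ∑ j ∈ Finset.range (m + 1), c j :=
  isBoundedUnder_of ⟨-(2 * B), fun m => (abs_le.1 (abs_average_le hc m)).1⟩

theorem abs_meanPayoff_le {c : ℕ → ℝ} {B : ℝ} (hc : ∀ j, |c j| ≤ B) :
    |meanPayoff c| ≤ 2 * B :=
  abs_le.2
    ⟨le_liminf_of_le (isBoundedUnder_le_average hc).isCoboundedUnder_ge
        (.of_forall fun m => (abs_le.1 (abs_average_le hc m)).1),
      (liminf_le_limsup (isBoundedUnder_le_average hc) (isBoundedUnder_ge_average hc)).trans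
        (limsup_le_of_le (isBoundedUnder_ge_average hc).isCoboundedUnder_le
          (.of_forall fun m => (abs_le.1 (abs_average_le hc m)).2))⟩

theorem meanPayoff_suffix_one {c : ℕ → ℝ} {B : ℝ} (hc : ∀ j, |c j| ≤ B) :
    meanPayoff (suffix c 1) = meanPayoff c := by
  refine liminf_eq_of_tendsto_sub (isBoundedUnder_le_average hc) (isBoundedUnder_ge_average hc) ?_
  have hdiff (m : ℕ) : (1 / (m : ℝ)) * ∑ j ∈ Finset.range (m + 1), suffix c 1 j
      - (1 / (m : ℝ)) * ∑ j ∈ Finset.range (m + 1), c j = (1 / (m : ℝ)) * (c (m + 1) - c 0) := by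
    rw [← mul_sub, ← Finset.sum_sub_distrib, ← Finset.sum_range_sub]
    simp only [suffix, add_comm 1]
  simp only [hdiff]
  refine tendsto_one_div_atTop_nhds_zero_nat.zero_mul_isBoundedUnder_le
    (isBoundedUnder_of ⟨B + B, fun m => ?_⟩)
  exact (abs_sub _ _).trans (add_le_add (hc _) (hc _))

theorem meanPayoff_suffix {c : ℕ → ℝ} {B : ℝ} (hc : ∀ j, |c j| ≤ B) (t : ℕ) :
    meanPayoff (suffix c t) = meanPayoff c := by
  induction t with
  | zero => rw [suffix_zero]
  | succ t ih =>
    have hsuffix (j : ℕ) : |suffix c t j| ≤ B := hc (t + j)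
    rw [suffix_add, meanPayoff_suffix_one hsuffix, ih]

theorem measurable_meanPayoff : Measurable meanPayoff :=
  Measurable.liminf fun m => by fun_prop

theorem MDP.abs_payoff_le {S A : Type*} (M : MDP S A) {B : ℝ} (hB : ∀ s, |M.reward s| ≤ B)
    (r : ℕ → History S) : |M.payoff r| ≤ 2 * B :=
  abs_meanPayoff_le fun j => hB (r j).cur

theorem MDP.measurable_payoff {S A : Type*} (M : MDP S A) : Measurable M.payoff :=
  measurable_meanPayoff.comp <| measurable_pi_lambda _ fun j =>
    (Measurable.of_discrete (f := fun u : History S => M.reward u.cur)).comp (measurable_pi_apply j)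

/-! ### Acceptance of random words -/

section RecurrentStates

theorem infStates_nonempty {Q : Type*} [Finite Q] (r : ℕ → Q) : (infStates r).Nonempty :=
  frequently_exists.1 (Frequently.of_forall fun j => ⟨r j, rfl⟩)

theorem eventually_mem_infStates {Q : Type*} [Finite Q] (r : ℕ → Q) :
    ∀ᶠ j in atTop, r j ∈ infStates r := by
  by_contra h
  have hexists : ∃ᶠ j in atTop, ∃ q, r j = q ∧ q ∉ infStates r :=
    (not_eventually.1 h).mono fun j hj => ⟨r j, rfl, hj⟩
  obtain ⟨q, hq⟩ := frequently_exists.1 hexists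
  obtain ⟨-, -, hq_notMem⟩ := hq.exists
  exact hq_notMem (hq.mono fun j hj => hj.1)

variable {X Q : Type*} (A : DPW X Q)

theorem DPW.dependsOn_run (j : ℕ) : DependsOn (fun w => A.run w j) (Set.Iio j) :=
  dependsOn_Iio_of_step (r := fun j w => A.run w j) (F := A.step) (fun _ => rfl) (fun _ _ => rfl) j

theorem DPW.ae_infStates_step_mem [Countable Q] [Countable X] [MeasurableSpace X]
    [MeasurableSingletonClass X] (ν : Measure X) [IsProbabilityMeasure ν] (hν : ∀ x, ν {x} ≠ 0) :
    ∀ᵐ w ∂iidLaw ν, ∀ q ∈ infStates (A.run w), ∀ x, A.step q x ∈ infStates (A.run w) := by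
  have hvisit q n : MeasurableSet[letterFiltration X n] {w | A.run w (n + 1) = q} := by
    refine measurableSet_letterFiltration_of_dependsOn fun w w' h => ?_
    have hrun : A.run w (n + 1) = A.run w' (n + 1) :=
      A.dependsOn_run (n + 1) fun i hi => h i (Nat.lt_succ_iff.1 hi)
    simp only [Set.mem_ofPred_eq, hrun]
  have hread : ∀ᵐ w ∂iidLaw ν, ∀ q x, (∃ᶠ n in atTop, A.run w (n + 1) = q) →
      ∃ᶠ n in atTop, A.run w (n + 1) = q ∧ w (n + 1) = x :=
    ae_all_iff.2 fun q => ae_all_iff.2 fun x =>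
      ae_frequently_mem_and_eval_succ_mem ν (measurableSet_singleton x) (hν x) (hvisit q)
  filter_upwards [hread] with w hw q hq x
  have hq' : ∃ᶠ n in atTop, A.run w (n + 1) = q := by
    rwa [infStates, Set.mem_ofPred_eq, ← map_add_atTop_eq_nat 1, frequently_map] at hq
  refine (tendsto_add_atTop_nat 2).frequently ((hw q x hq').mono fun n hn => ?_)
  rw [DPW.run, hn.1, hn.2]

end RecurrentStates

section ErgodicComponents

variable {I Q : Type*} [Fintype I] {A : DPW (Finset I) Q} {w : ℕ → Finset I}

theorem inputChain_trans_pos_iff {x y : Q} :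
    0 < (inputChain A).trans x y ↔ ∃ i, A.step x i = y := by
  rw [PMF.apply_pos_iff, inputChain, PMF.mem_support_map_iff]
  simp only [PMF.mem_support_uniformOfFintype, true_and]

theorem MarkovChain.IsErgodicComponent.step_mem {C : Set Q}
    (hC : (inputChain A).IsErgodicComponent C) {q : Q} (hq : q ∈ C) (i : Finset I) :
    A.step q i ∈ C := by
  by_contra h
  exact (inputChain_trans_pos_iff.2 ⟨i, rfl⟩).ne' (hC.2.2 q hq _ h)

theorem MarkovChain.IsErgodicComponent.subset_of_step_mem {C D : Set Q}
    (hC : (inputChain A).IsErgodicComponent C) (hD : ∀ q ∈ D, ∀ i, A.step q i ∈ D)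
    (hCD : (C ∩ D).Nonempty) : C ⊆ D := by
  intro t ht
  obtain ⟨q, hqC, hqD⟩ := hCD
  induction hC.2.1 q hqC t ht with
  | refl => exact hqD
  | tail _ hstep ih =>
    obtain ⟨i, rfl⟩ := inputChain_trans_pos_iff.1 hstep.2.2
    exact hD _ (ih hstep.1) i

theorem MarkovChain.IsErgodicComponent.infStates_run_subset {C : Set Q}
    (hC : (inputChain A).IsErgodicComponent C) {j : ℕ} (hj : A.run w j ∈ C) :
    infStates (A.run w) ⊆ C := by
  have hstay : ∀ k ≥ j, A.run w k ∈ C := fun k hk => by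
    induction k, hk using Nat.le_induction with
    | base => exact hj
    | succ k _ ih => exact hC.step_mem ih (w k)
  intro q hq
  obtain ⟨k, hk, rfl⟩ := frequently_atTop.1 hq j
  exact hstay k hk

theorem isErgodicComponent_infStates_run [Finite Q]
    (hw : ∀ q ∈ infStates (A.run w), ∀ i, A.step q i ∈ infStates (A.run w)) :
    (inputChain A).IsErgodicComponent (infStates (A.run w)) := by
  refine ⟨infStates_nonempty _, fun s hs t ht => ?_, fun s hs t ht => ?_⟩
  · obtain ⟨N, hN⟩ := eventually_atTop.1 (eventually_mem_infStates (A.run w))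
    obtain ⟨a, ha, rfl⟩ := frequently_atTop.1 hs N
    obtain ⟨b, hb, rfl⟩ := frequently_atTop.1 ht a
    clear hs ht
    induction b, hb using Nat.le_induction with
    | base => exact .refl
    | succ b hb ih =>
      exact ih.tail ⟨hN b (ha.trans hb), hN (b + 1) (ha.trans (hb.trans b.le_succ)),
        inputChain_trans_pos_iff.2 ⟨w b, rfl⟩⟩
  · by_contra h
    obtain ⟨i, rfl⟩ := inputChain_trans_pos_iff.1 (pos_iff_ne_zero.2 h)
    exact ht (hw s hs i)

theorem visits_isRejectingComponent_iff [Finite Q]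
    (hw : ∀ q ∈ infStates (A.run w), ∀ i, A.step q i ∈ infStates (A.run w)) :
    (∃ j, ∃ C, IsRejectingComponent A C ∧ A.run w j ∈ C) ↔
      IsRejectingComponent A (infStates (A.run w)) := by
  constructor
  · rintro ⟨j, C, hC, hj⟩
    have hsubset := hC.1.infStates_run_subset hj
    have hmeets : (C ∩ infStates (A.run w)).Nonempty :=
      (infStates_nonempty _).mono fun q hq => ⟨hsubset hq, hq⟩
    rwa [hsubset.antisymm (hC.1.subset_of_step_mem hw hmeets)]
  · intro h
    obtain ⟨j, hj⟩ := (eventually_mem_infStates (A.run w)).exists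
    exact ⟨j, _, h, hj⟩

theorem DPW.mem_language_iff_not_isRejectingComponent [Finite Q]
    (hw : ∀ q ∈ infStates (A.run w), ∀ i, A.step q i ∈ infStates (A.run w)) :
    w ∈ A.language ↔ ¬ IsRejectingComponent A (infStates (A.run w)) := by
  have hbdd : BddAbove (A.rank '' infStates (A.run w)) :=
    ⟨A.index, Set.forall_mem_image.2 fun q _ => (A.rank_mem q).2⟩
  obtain ⟨m, hm⟩ := hbdd.exists_isGreatest_of_nonempty ((infStates_nonempty _).image A.rank)
  have heven : w ∈ A.language ↔ Even m :=
    ⟨fun ⟨k, hk, hk'⟩ => hm.unique hk ▸ hk', fun h => ⟨m, hm, h⟩⟩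
  have hodd : IsRejectingComponent A (infStates (A.run w)) ↔ Odd m :=
    ⟨fun ⟨_, k, hk, hk'⟩ => hm.unique hk ▸ hk',
      fun h => ⟨isErgodicComponent_infStates_run hw, m, hm, h⟩⟩
  rw [heven, hodd, Nat.not_odd_iff_even]

end ErgodicComponents

instance (I : Type*) [Fintype I] : IsProbabilityMeasure (inputMeasure I) :=
  inferInstanceAs (IsProbabilityMeasure (iidLaw _))

theorem DPW.ae_mem_language_iff {I Q : Type*} [Fintype I] [Finite Q] (A : DPW (Finset I) Q) :
    ∀ᵐ w ∂inputMeasure I,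
      w ∈ A.language ↔ ∀ j, ¬ ∃ C, IsRejectingComponent A C ∧ A.run w j ∈ C := by
  have hpos (i : Finset I) : (PMF.uniformOfFintype (Finset I)).toMeasure {i} ≠ 0 := by
    rw [PMF.toMeasure_apply_singleton _ _ (measurableSet_singleton _)]
    simp
  filter_upwards [A.ae_infStates_step_mem _ hpos] with w hw
  rw [A.mem_language_iff_not_isRejectingComponent hw, ← visits_isRejectingComponent_iff hw,
    not_exists]

/-! ### Random runs -/

section Cone

variable {S : Type*}

/-- The cone of the finite path `u 0, …, u n`: the runs that start with it. -/
def cone (u : ℕ → S) (n : ℕ) : Set (ℕ → S) := {r | ∀ j ≤ n, r j = u j}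

variable [MeasurableSpace S]

theorem measurableSet_cone [MeasurableSingletonClass S] (u : ℕ → S) (n : ℕ) :
    MeasurableSet (cone u n) := by
  simp only [cone, Set.ofPred_forall]
  exact .iInter fun j => .iInter fun _ =>
    (measurableSet_singleton (u j)).preimage (measurable_pi_apply j)

theorem ext_of_cone [Countable S] [MeasurableSingletonClass S] {μ μ' : Measure (ℕ → S)}
    [IsFiniteMeasure μ'] (h : ∀ u n, μ (cone u n) = μ' (cone u n)) :
    μ = μ' := by
  have hfamily : IsProjectiveMeasureFamily (α := fun _ : ℕ => S) fun J => μ'.map J.restrict := by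
    intro J K hKJ
    beta_reduce
    rw [Measure.map_map (Finset.measurable_restrict₂ hKJ) (Finset.measurable_restrict J)]
    rfl
  have hlim : IsProjectiveLimit μ (α := fun _ : ℕ => S) (fun J => μ'.map J.restrict) := by
    rw [isProjectiveLimit_nat_iff hfamily]
    intro n
    refine Measure.ext_of_singleton fun a => ?_
    have hcone : (Preorder.frestrictLe (π := fun _ : ℕ => S) n) ⁻¹' {a} =
        cone (fun j => if hj : j ≤ n then a ⟨j, Finset.mem_Iic.2 hj⟩ else a ⟨0, by simp⟩) n := by
      ext r
      simp +contextual [cone, funext_iff, Preorder.frestrictLe]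
    rw [Measure.map_apply (Preorder.measurable_frestrictLe n) (measurableSet_singleton a),
      Measure.map_apply (Finset.measurable_restrict _) (measurableSet_singleton a), hcone,
      h, ← hcone]
    rfl
  exact hlim.unique fun J => rfl

theorem ext_of_cone_of_eval_zero [Countable S] [MeasurableSingletonClass S] {s : S}
    {μ μ' : Measure (ℕ → S)} [IsFiniteMeasure μ']
    (hμ : ∀ᵐ r ∂μ, r 0 = s) (hμ' : ∀ᵐ r ∂μ', r 0 = s)
    (h : ∀ u, u 0 = s → ∀ n, μ (cone u n) = μ' (cone u n)) : μ = μ' := by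
  have hnull {σ : Measure (ℕ → S)} (hσ : ∀ᵐ r ∂σ, r 0 = s) {u : ℕ → S} (hu : u 0 ≠ s) (n : ℕ) :
      σ (cone u n) = 0 :=
    measure_eq_zero_iff_ae_notMem.2 <| hσ.mono fun r hr₀ hr => hu ((hr 0 n.zero_le).symm.trans hr₀)
  refine ext_of_cone fun u n => ?_
  by_cases hu : u 0 = s
  · exact h u hu n
  · rw [hnull hμ hu, hnull hμ' hu]

instance [Countable S] [DiscreteMeasurableSpace S] (M : MarkovChain S) :
    IsProbabilityMeasure M.runMeasure := by
  unfold MarkovChain.runMeasure; infer_instance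

theorem MarkovChain.ae_runMeasure_eval_zero [Countable S] [DiscreteMeasurableSpace S]
    (M : MarkovChain S) : ∀ᵐ r ∂M.runMeasure, r 0 = M.init := by
  have h := M.runMeasure_cone (fun _ => M.init) rfl 0
  rw [Finset.range_zero, Finset.prod_empty] at h
  filter_upwards [(mem_ae_iff_prob_eq_one (measurableSet_cone (fun _ => M.init) 0)).2 h] with r hr
  exact hr 0 le_rfl

end Cone

section InputRun

variable {I O S : Type*}

theorem dependsOn_inputRun (δ : S → Finset (I ⊕ O) → S) (s₀ : S) (f : Strategy S (Finset O))
    (j : ℕ) : DependsOn (fun w => inputRun δ s₀ f w j) (Set.Iio j) :=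
  dependsOn_Iio_of_step (r := fun j w => inputRun δ s₀ f w j)
    (F := fun u i => u.snoc (δ u.cur (i.disjSum (f u)))) (fun _ => rfl) (fun _ _ => rfl) j

theorem measurable_inputRun [Countable I] (δ : S → Finset (I ⊕ O) → S) (s₀ : S)
    (f : Strategy S (Finset O)) : Measurable fun w => inputRun δ s₀ f w :=
  measurable_pi_lambda _ fun j =>
    (measurable_letterFiltration_of_dependsOn
      ((dependsOn_inputRun δ s₀ f j).mono Set.Iio_subset_Iic_self)).mono
      (Filtration.le _ j) le_rfl

variable [Fintype I]

theorem MDP.integrable_payoff_inputRun (M : MDP S (Finset O)) {B : ℝ} (hB : ∀ s, |M.reward s| ≤ B)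
    (δ : S → Finset (I ⊕ O) → S) (f : Strategy S (Finset O)) :
    Integrable (fun w => M.payoff (inputRun δ M.init f w)) (inputMeasure I) :=
  .of_bound (M.measurable_payoff.comp (measurable_inputRun δ M.init f)).aestronglyMeasurable (2 * B)
    (.of_forall fun _ => M.abs_payoff_le hB _)

variable [Countable S]

theorem runMeasure_eq_map_inputRun {M : MDP S (Finset O)} {δ : S → Finset (I ⊕ O) → S}
    (hδ : M.trans = inducedTrans δ) (f : Strategy S (Finset O)) :
    (M.chain f).runMeasure = (inputMeasure I).map fun w => inputRun δ M.init f w := by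
  have hmeas := measurable_inputRun δ M.init f
  have := Measure.isProbabilityMeasure_map (μ := inputMeasure I) hmeas.aemeasurable
  refine ext_of_cone_of_eval_zero (M.chain f).ae_runMeasure_eval_zero ?_ fun u hu n => ?_
  · exact (ae_map_iff hmeas.aemeasurable (measurable_pi_apply 0 (measurableSet_singleton _))).2
      (.of_forall fun _ => rfl)
  · rw [Measure.map_apply hmeas (measurableSet_cone u n)]
    exact ((M.chain f).runMeasure_cone u hu n).trans (inputMeasure_cone M δ hδ f u hu n).symm

theorem MDP.val_eq_integral_inputRun {M : MDP S (Finset O)} {δ : S → Finset (I ⊕ O) → S}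
    (hδ : M.trans = inducedTrans δ) (f : Strategy S (Finset O)) :
    M.val f = ∫ w, M.payoff (inputRun δ M.init f w) ∂inputMeasure I := by
  rw [MDP.val, runMeasure_eq_map_inputRun hδ, integral_map
    (measurable_inputRun δ M.init f).aemeasurable M.measurable_payoff.aestronglyMeasurable]

end InputRun

/-! ### Restarting a strategy -/

section SinceReset

variable {S : Type*} {R : Set S} {u : History S}

open Classical in
/-- The part of a history after the last visit, before the current state, to a state of `R`. -/
noncomputable def History.sinceReset (R : Set S) (u : History S) : History S :=
  ⟨u.past.rtakeWhile (· ∉ R), u.cur⟩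

theorem History.sinceReset_snoc_of_mem (h : u.cur ∈ R) (s : S) :
    (u.snoc s).sinceReset R = ⟨[], s⟩ := by
  simp [History.sinceReset, History.snoc, h]

theorem History.sinceReset_snoc_of_notMem (h : u.cur ∉ R) (s : S) :
    (u.snoc s).sinceReset R = (u.sinceReset R).snoc s := by
  simp [History.sinceReset, History.snoc, h]

end SinceReset

section Restart

variable {I O S A : Type*}

/-- The strategy that plays `f` and forgets the past after each visit to a state of `R`. -/
noncomputable def restart (R : Set S) (f : Strategy S A) : Strategy S A :=
  fun u => f (u.sinceReset R)

open Classical in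
/-- The transition function that agrees with `δ`, except that it moves from the states of `R` to
`s₀`. -/
noncomputable def resetStep {X : Type*} (R : Set S) (s₀ : S) (δ : S → X → S) (s : S) (a : X) : S :=
  if s ∈ R then s₀ else δ s a

open Classical in
/-- The MDP that agrees with `M`, except that every action leads from the states of `R` to the
initial state with probability one. -/
noncomputable def MDP.reset (M : MDP S A) (R : Set S) : MDP S A where
  init := M.init
  trans s a := if s ∈ R then PMF.pure M.init else M.trans s a
  reward := M.reward

theorem MDP.reset_trans [Fintype I] {M : MDP S (Finset O)} {δ : S → Finset (I ⊕ O) → S}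
    (hδ : M.trans = inducedTrans δ) (R : Set S) :
    (M.reset R).trans = inducedTrans (resetStep R M.init δ) := by
  funext s o
  by_cases hs : s ∈ R
  · simp only [MDP.reset, inducedTrans, resetStep, if_pos hs]
    exact (PMF.map_const _ _).symm
  · simp only [MDP.reset, inducedTrans, resetStep, if_neg hs, hδ]

/-- The run of the restarted strategy `restart R f` in the pre-automaton that is reset on `R`. -/
noncomputable abbrev restartRun (R : Set S) (δ : S → Finset (I ⊕ O) → S) (s₀ : S)
    (f : Strategy S (Finset O)) (w : ℕ → Finset I) : ℕ → History S :=
  inputRun (resetStep R s₀ δ) s₀ (restart R f) w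

variable {R : Set S} {δ : S → Finset (I ⊕ O) → S} {s₀ : S} {f : Strategy S (Finset O)}
  {w : ℕ → Finset I} {t : ℕ}

theorem sinceReset_restartRun_of_notMem (h : ∀ j < t, (inputRun δ s₀ f w j).cur ∉ R) :
    (restartRun R δ s₀ f w t).sinceReset R = inputRun δ s₀ f w t := by
  induction t with
  | zero => rfl
  | succ t ih =>
    have hrun := ih fun j hj => h j (hj.trans t.lt_succ_self)
    have hcur : (restartRun R δ s₀ f w t).cur = (inputRun δ s₀ f w t).cur :=
      (History.ext_iff.1 hrun).2
    have hnotMem := h t t.lt_succ_self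
    rw [restartRun, inputRun, History.sinceReset_snoc_of_notMem (hcur ▸ hnotMem), hrun, inputRun,
      restart, hrun, resetStep, hcur, if_neg hnotMem]

theorem cur_restartRun_of_notMem (h : ∀ j < t, (inputRun δ s₀ f w j).cur ∉ R) :
    (restartRun R δ s₀ f w t).cur = (inputRun δ s₀ f w t).cur :=
  (History.ext_iff.1 (sinceReset_restartRun_of_notMem h)).2

theorem sinceReset_restartRun_add (ht : (restartRun R δ s₀ f w t).cur ∈ R) (k : ℕ) :
    (restartRun R δ s₀ f w (t + 1 + k)).sinceReset R =
      (restartRun R δ s₀ f (suffix w (t + 1)) k).sinceReset R := by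
  induction k with
  | zero =>
    rw [add_zero, restartRun, inputRun, History.sinceReset_snoc_of_mem ht, resetStep, if_pos ht]
    rfl
  | succ k ih =>
    have hcur : (restartRun R δ s₀ f w (t + 1 + k)).cur =
        (restartRun R δ s₀ f (suffix w (t + 1)) k).cur := (History.ext_iff.1 ih).2
    rw [← add_assoc, restartRun, restartRun, inputRun, inputRun, restart, restart, ih, hcur]
    by_cases hR : (restartRun R δ s₀ f (suffix w (t + 1)) k).cur ∈ R
    · rw [History.sinceReset_snoc_of_mem hR, History.sinceReset_snoc_of_mem (hcur ▸ hR)]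
      rfl
    · rw [History.sinceReset_snoc_of_notMem hR, History.sinceReset_snoc_of_notMem (hcur ▸ hR), ih]
      rfl

theorem cur_restartRun_add (ht : (restartRun R δ s₀ f w t).cur ∈ R) (k : ℕ) :
    (restartRun R δ s₀ f w (t + 1 + k)).cur = (restartRun R δ s₀ f (suffix w (t + 1)) k).cur :=
  (History.ext_iff.1 (sinceReset_restartRun_add ht k)).2

end Restart

section Renewal

variable {I O S : Type*}

/-- The input words on which the strategy `f` is in a state of `R` at time `t`. -/
def visiting (R : Set S) (δ : S → Finset (I ⊕ O) → S) (s₀ : S) (f : Strategy S (Finset O))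
    (t : ℕ) : Set (ℕ → Finset I) :=
  {w | (inputRun δ s₀ f w t).cur ∈ R}

theorem measurableSet_visiting [Countable I] (R : Set S) (δ : S → Finset (I ⊕ O) → S) (s₀ : S)
    (f : Strategy S (Finset O)) (t : ℕ) :
    MeasurableSet[letterFiltration (Finset I) t] (visiting R δ s₀ f t) :=
  measurableSet_letterFiltration_of_dependsOn fun _ _ h =>
    congrArg (fun u : History S => u.cur ∈ R)
      (dependsOn_inputRun δ s₀ f t fun i hi => h i (Set.Iio_subset_Iic_self hi))

theorem cur_notMem_of_mem_disjointed_visiting {R : Set S} {δ : S → Finset (I ⊕ O) → S} {s₀ : S}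
    {f : Strategy S (Finset O)} {w : ℕ → Finset I} {t : ℕ}
    (hw : w ∈ disjointed (visiting R δ s₀ f) t) : ∀ j < t, (inputRun δ s₀ f w j).cur ∉ R := by
  rw [disjointed_eq_inter_compl] at hw
  exact fun j hj => Set.mem_iInter₂.1 hw.2 j hj

theorem MDP.payoff_restartRun_of_mem_disjointed_visiting (M : MDP S (Finset O)) {B : ℝ}
    (hB : ∀ s, |M.reward s| ≤ B) {R : Set S} {δ : S → Finset (I ⊕ O) → S} {s₀ : S}
    {f : Strategy S (Finset O)} {w : ℕ → Finset I} {t : ℕ}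
    (hw : w ∈ disjointed (visiting R δ s₀ f) t) :
    M.payoff (restartRun R δ s₀ f w) = M.payoff (restartRun R δ s₀ f (suffix w (t + 1))) := by
  have hmem : (restartRun R δ s₀ f w t).cur ∈ R := by
    rw [cur_restartRun_of_notMem (cur_notMem_of_mem_disjointed_visiting hw)]
    exact disjointed_subset _ t hw
  refine (meanPayoff_suffix (fun j => hB (restartRun R δ s₀ f w j).cur) (t + 1)).symm.trans ?_
  exact congrArg meanPayoff (funext fun k => congrArg M.reward (cur_restartRun_add hmem k))

theorem MDP.measureReal_mul_val_reset_restart [Fintype I] [Countable S] {M : MDP S (Finset O)}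
    {B : ℝ} (hB : ∀ s, |M.reward s| ≤ B) {δ : S → Finset (I ⊕ O) → S}
    (hδ : M.trans = inducedTrans δ) (R : Set S) (f : Strategy S (Finset O)) :
    (inputMeasure I).real (⋃ t, visiting R δ M.init f t)ᶜ * (M.reset R).val (restart R f) =
      ∫ w in (⋃ t, visiting R δ M.init f t)ᶜ, M.payoff (inputRun δ M.init f w) ∂inputMeasure I := by
  have hvisiting := measurableSet_visiting R δ M.init f
  have hpayoff : Measurable fun w => M.payoff (restartRun R δ M.init f w) :=
    M.measurable_payoff.comp (measurable_inputRun _ _ _)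
  have hnever : MeasurableSet (⋃ t, visiting R δ M.init f t)ᶜ :=
    (MeasurableSet.iUnion fun t => Filtration.le _ t _ (hvisiting t)).compl
  rw [MDP.val_eq_integral_inputRun (MDP.reset_trans hδ R)]
  refine (measureReal_mul_integral_of_renewal _ hvisiting hpayoff
    (M.integrable_payoff_inputRun hB _ _)
    fun t w => M.payoff_restartRun_of_mem_disjointed_visiting hB).trans ?_
  refine setIntegral_congr_fun hnever fun w hw => ?_
  have hnotMem (j : ℕ) : (inputRun δ M.init f w j).cur ∉ R := fun hj =>
    hw (Set.mem_iUnion.2 ⟨j, hj⟩)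
  exact congrArg meanPayoff (funext fun j =>
    congrArg M.reward (cur_restartRun_of_notMem fun i _ => hnotMem i))

end Renewal

/-! ### The reset MDP -/

section ResetMDP

variable {I O : Type*} [Fintype I] {n : ℕ} {Qψ : Type*} {Q : Fin n → Type*}

/-- The states of the product whose `A_ψ`-component lies in a rejecting ergodic component. -/
def rejectingStates (Aψ : DPW (Finset I) Qψ) (Q : Fin n → Type*) : Set (Qψ × (∀ l, Q l)) :=
  {s | ∃ C, IsRejectingComponent Aψ C ∧ s.1 ∈ C}

variable (Aψ : DPW (Finset I) Qψ) (v : Fin n → ℝ) (A : ∀ l, DPW (Finset (I ⊕ O)) (Q l))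

theorem resetMDP_eq_reset : resetMDP Aψ v A = (condMDP Aψ v A).reset (rejectingStates Aψ Q) :=
  rfl

theorem condMDP_reward_mem (s : Qψ × (∀ l, Q l)) :
    (condMDP Aψ v A).reward s ∈ insert 0 (Set.range v) := by
  classical
  let X := {x | ∃ l, v l = x ∧ ∃ q U, IsCWR (A l) q U ∧ s.2 l ∈ U}
  have hX : X ⊆ Set.range v := fun x ⟨l, hl, _⟩ => ⟨l, hl⟩
  have hreward : (condMDP Aψ v A).reward s =
      if ∃ C, IsEndComponent (inducedTrans (prodStep Aψ A)) C ∧ s ∈ C then sSup X else 0 := rfl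
  rw [hreward]
  split_ifs
  · rcases X.eq_empty_or_nonempty with hempty | hne
    · exact .inl (by rw [hempty, Real.sSup_empty])
    · exact .inr (hX (hne.csSup_mem ((Set.finite_range v).subset hX)))
  · exact .inl rfl

theorem exists_abs_condMDP_reward_le : ∃ B, ∀ s, |(condMDP Aψ v A).reward s| ≤ B := by
  obtain ⟨B, hB⟩ := (((Set.finite_range v).insert 0).image abs).bddAbove
  exact ⟨B, fun s => hB (Set.mem_image_of_mem _ (condMDP_reward_mem Aψ v A s))⟩

variable {v} (f : Strategy (Qψ × (∀ l, Q l)) (Finset O))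

theorem fst_cur_inputRun_condMDP (w : ℕ → Finset I) (j : ℕ) :
    (inputRun (prodStep Aψ A) (condMDP Aψ v A).init f w j).cur.1 = Aψ.run w j := by
  induction j with
  | zero => rfl
  | succ j ih =>
    simp only [inputRun, History.snoc, prodStep, DPW.run, ih, Finset.toLeft_disjSum]

theorem language_ae_eq_compl_iUnion_visiting [Finite Qψ] :
    Aψ.language =ᵐ[inputMeasure I]
      ((⋃ t, visiting (rejectingStates Aψ Q) (prodStep Aψ A) (condMDP Aψ v A).init f t)ᶜ :
        Set (ℕ → Finset I)) := by
  refine eventuallyEq_set.2 (Aψ.ae_mem_language_iff.mono fun w hw => hw.trans ?_)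
  rw [Set.mem_compl_iff, Set.mem_iUnion, not_exists]
  simp only [visiting, rejectingStates, Set.mem_ofPred_eq, fst_cur_inputRun_condMDP]

theorem val_resetMDP_restart [Finite Qψ] [∀ l, Countable (Q l)] {ψ : LTL I}
    (hψ : 0 < inputMeasure I {w | ψ.Sat w}) (hAψ : Aψ.language = {w | ψ.Sat w}) :
    (resetMDP Aψ v A).val (restart (rejectingStates Aψ Q) f) = condVal ψ Aψ v A f := by
  obtain ⟨B, hB⟩ := exists_abs_condMDP_reward_le Aψ v A
  have hrenewal := MDP.measureReal_mul_val_reset_restart hB (δ := prodStep Aψ A) rfl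
    (rejectingStates Aψ Q) f
  have hsat := language_ae_eq_compl_iUnion_visiting (v := v) Aψ A f
  rw [hAψ] at hsat
  have hpos : (inputMeasure I).real {w | ψ.Sat w} ≠ 0 :=
    (ENNReal.toReal_pos hψ.ne' (measure_ne_top _ _)).ne'
  rw [← measureReal_congr hsat, ← Measure.restrict_congr_set hsat] at hrenewal
  rw [resetMDP_eq_reset, condVal, ProbabilityTheory.cond, integral_smul_measure, ENNReal.toReal_inv,
    smul_eq_mul, ← measureReal_def, eq_inv_mul_iff_mul_eq₀ hpos]
  exact hrenewal

end ResetMDP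

end QualSynth

theorem mainTheorem8_general {I O : Type*} [Fintype I] (ψ : QualSynth.LTL I)
    (hψ : 0 < QualSynth.inputMeasure I {w | ψ.Sat w}) {n : ℕ} (val : Fin n → ℝ)
    {Qψ : Type*} [Finite Qψ] (Aψ : QualSynth.DPW (Finset I) Qψ)
    (hAψ : Aψ.language = {w | ψ.Sat w})
    {Q : Fin n → Type*} [∀ l, Countable (Q l)] (A : ∀ l, QualSynth.DPW (Finset (I ⊕ O)) (Q l))
    (f : QualSynth.Strategy (Qψ × (∀ l, Q l)) (Finset O)) :
    ∃ g : QualSynth.Strategy (Qψ × (∀ l, Q l)) (Finset O),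
      (QualSynth.resetMDP Aψ val A).val g = QualSynth.condVal ψ Aψ val A f :=
  ⟨_, QualSynth.val_resetMDP_restart Aψ A f hψ hAψ⟩

theorem mainTheorem8 {I O : Type*} [Fintype I] [Fintype O]
    {F : (k : ℕ) → Set ((Fin k → unitInterval) → unitInterval)}
    (φ : QualSynth.FLTL (I ⊕ O) F) (ψ : QualSynth.LTL I)
    (hψ : 0 < QualSynth.inputMeasure I {w | ψ.Sat w})
    {n : ℕ} (val : Fin n → ℝ) (hmono : StrictMono val) (hval : Set.range val = φ.values)
    {Qψ : Type*} [Finite Qψ] (Aψ : QualSynth.DPW (Finset I) Qψ)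
    (hAψ : Aψ.language = {w | ψ.Sat w})
    {Q : Fin n → Type*} [∀ l, Finite (Q l)] (A : ∀ l, QualSynth.DPW (Finset (I ⊕ O)) (Q l))
    (hA : ∀ l, (A l).language = {π | (φ.sem π : ℝ) = val l})
    (v : ℝ) (f : QualSynth.Strategy (Qψ × (∀ l, Q l)) (Finset O))
    (hf : v ≤ QualSynth.condVal ψ Aψ val A f) :
    ∃ g : QualSynth.Strategy (Qψ × (∀ l, Q l)) (Finset O),
      v ≤ (QualSynth.resetMDP Aψ val A).val g :=
  let ⟨g, hg⟩ := mainTheorem8_general ψ hψ val Aψ hAψ A f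
  ⟨g, hf.trans_eq hg.symm⟩
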